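/- Let $n\ge 1$ and let $\Omega\subset\mathbb{C}^n$ be a domain (nonempty, open and connected) that is Carathéodory hyperbolic: for all $z_1\ne z_2$ in $\Omega$, $$c^*_\Omega(z_1,z_2)=\sup\Big\{\Big|\tfrac{f(z_1)-f(z_2)}{1-f(z_1)\overline{f(z_2)}}\Big| : f:\Omega\to\mathbb{D}\text{ holomorphic}\Big\}>0 .$$ Let $\mathscr{S}(\Omega)$ be the set of holomorphic $f:\Omega\to\mathbb{C}$ with $|f|\le 1$. For a set $\Psi$ of functions from $\Omega$ to $\overline{\mathbb{D}}$, with the topology of pointwise convergence, let $\mathcal{C}_b(\Psi)$ be the $C^*$-algebra of bounded continuous functions $\Psi\to\mathbb{C}$, and for $z\in\Omega$ let $E(z)\in\mathcal{C}_b(\Psi)$ be given by $E(z)(\psi)=\psi(z)$. Such a $\Psi$ is a set of test functions if (i) $\sup_{\psi\in\Psi}|\psi(z)|<1$ for each $z\in\Omega$, and (ii) for each finite $F\subset\Omega$ the restrictions $\psi|_F$ $(\psi\in\Psi)$ together with the constants generate the algebra of all functions $F\to\mathbb{C}$. A positive semidefinite kernel $k:\Omega\times\Omega\to\mathbb{C}$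 is $\Psi$-admissible if $(1-\psi(z)\overline{\psi(w)})k(z,w)$ is a positive semidefinite kernel for every $\psi\in\Psi$. The Schur-Agler class $\mathscr{SA}_\Psi$ consists of the functions $f:\Omega\to\mathbb{C}$ such that $(1-f(z)\overline{f(w)})k(z,w)$ is positive semidefinite for every $\Psi$-admissible $k$. Let $\Psi$ be either (a) the universal family $\Big\{z\mapsto\dfrac{f(w_0)-f(z)}{1-\overline{f(w_0)}f(z)} : f:\Omega\to\mathbb{D}\text{ holomorphic}\Big\}$ for some point $w_0\in\Omega$; or (b) any set of test functions such that $\Psi\subset\mathscr{S}(\Omega)$, all members of $\Psi$ vanish at a common point $w_0\in\Omega$, and $\mathscr{SA}_\Psi=\mathscr{S}(\Omega)$. Then for every holomorphic function $h:\Omega\to\mathbb{C}$ the following are equivalent. 1. $\mathrm{Re}\,h(z)\ge 0$ for all $z\in\Omega$. 2. There are a real number $b$, a complex Hilbert space $\mathscr{X}$, a unitary operator $U$ on $\mathscr{X}$, a vector $\gamma\in\mathscr{X}$ and a unital $*$-representation $\rho:\mathcal{C}_b(\Psi)\to B(\mathscr{X})$ such that, for all $z\in\Omega$, the operator $1-U\rho(E(z)^*)$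 is invertible and $$h(z)=ib+\big\langle\gamma,(1+U\rho(E(z)^*))(1-U\rho(E(z)^*))^{-1}\gamma\big\rangle ,$$ where the inner product is linear in the first and conjugate linear in the second variable. -/

import Mathlib

open scoped ComplexConjugate BoundedContinuousFunction ComplexOrder

noncomputable section

namespace HerglotzRep

/-- A domain in `ℂⁿ`: a nonempty connected open set. -/
def IsDomainIn {n : ℕ} (Ω : Set (EuclideanSpace ℂ (Fin n))) : Prop :=
  IsOpen Ω ∧ IsConnected Ω

/-- `f : Ω → ℂ` is holomorphic (for an open set `Ω`). -/
def IsHolomorphic {n : ℕ} {Ω : Set (EuclideanSpace ℂ (Fin n))} (f : Ω → ℂ) : Prop :=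
  ∃ F : EuclideanSpace ℂ (Fin n) → ℂ, DifferentiableOn ℂ F Ω ∧ ∀ z : Ω, F z = f z

/-- The Schur class: the closed unit ball of the algebra of bounded holomorphic functions. -/
def schurClass {n : ℕ} (Ω : Set (EuclideanSpace ℂ (Fin n))) : Set (Ω → ℂ) :=
  {f | IsHolomorphic f ∧ ∀ z, ‖f z‖ ≤ 1}

/-- The pseudohyperbolic distance on the open unit disc. -/
def pseudoHyp (a b : ℂ) : ℝ := ‖(a - b) / (1 - a * conj b)‖

/-- The Carathéodory pseudodistance `c*_Ω`. -/
def caratheodoryDist {n : ℕ} {Ω : Set (EuclideanSpace ℂ (Fin n))} (z w : Ω) : ℝ :=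
  sSup {d | ∃ f ∈ schurClass Ω, (∀ x, ‖f x‖ < 1) ∧ d = pseudoHyp (f z) (f w)}

/-- `Ω` is Carathéodory hyperbolic: the Carathéodory pseudodistance is a distance. -/
def IsCaratheodoryHyperbolic {n : ℕ} (Ω : Set (EuclideanSpace ℂ (Fin n))) : Prop :=
  ∀ z w : Ω, z ≠ w → 0 < caratheodoryDist z w

/-- Sets of test functions. -/
structure IsTestFunctions {S : Type*} (Ψ : Set (S → ℂ)) : Prop where
  /-- `sup {|ψ z| : ψ ∈ Ψ} < 1` for each `z`. -/
  sup_lt_one : ∀ z, ∃ r : ℝ, r < 1 ∧ ∀ ψ ∈ Ψ, ‖ψ z‖ ≤ r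
  /-- Restricted to a finite set `F`, `Ψ` and the constants generate all functions on `F`. -/
  generates : ∀ F : Finset S,
    Algebra.adjoin ℂ ((fun (ψ : S → ℂ) (x : F) => ψ x) '' Ψ) = ⊤

/-- Positive semidefinite kernels on a (possibly infinite) set: all the finite sums
`∑ conj (c z) * k z w * c w` are nonnegative. -/
def IsPSDKernel {S : Type*} (k : S → S → ℂ) : Prop :=
  (Matrix.of k).PosSemidef

/-- `Ψ`-admissible kernels. -/
def IsAdmissible {S : Type*} (Ψ : Set (S → ℂ)) (k : S → S → ℂ) : Prop :=
  IsPSDKernel k ∧ ∀ ψ ∈ Ψ, IsPSDKernel fun z w => (1 - ψ z * conj (ψ w)) * k z w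

/-- The `Ψ`-Schur-Agler class. -/
def schurAglerClass {S : Type*} (Ψ : Set (S → ℂ)) : Set (S → ℂ) :=
  {f | ∀ k, IsAdmissible Ψ k → IsPSDKernel fun z w => (1 - f z * conj (f w)) * k z w}

/-- The evaluation `E(z) ∈ C_b(Ψ)`, `E(z)(ψ) = ψ(z)`. Here `Ψ` carries the topology of pointwise
convergence. -/
def evalAt {S : Type*} (Ψ : Set (S → ℂ)) (hΨ : ∀ ψ ∈ Ψ, ∀ z, ‖ψ z‖ ≤ 1) (z : S) : Ψ →ᵇ ℂ :=
  BoundedContinuousFunction.ofNormedAddCommGroup (fun ψ : Ψ => (ψ : S → ℂ) z)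
    ((continuous_apply z).comp continuous_subtype_val) 1 (fun ψ => hΨ ψ ψ.2 z)

/-- The universal test functions based at `w₀`: all functions
`z ↦ (f w₀ - f z) / (1 - conj (f w₀) * f z)` with `f : Ω → 𝔻` holomorphic. -/
def universalTestFunctions {n : ℕ} {Ω : Set (EuclideanSpace ℂ (Fin n))} (w₀ : Ω) :
    Set (Ω → ℂ) :=
  {ψ | ∃ f ∈ schurClass Ω, (∀ z, ‖f z‖ < 1) ∧
    ψ = fun z => (f w₀ - f z) / (1 - conj (f w₀) * f z)}

theorem norm_moebius_le_one {a b : ℂ} (ha : ‖a‖ < 1) (hb : ‖b‖ < 1) :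
    ‖(a - b) / (1 - conj a * b)‖ ≤ 1 := by
  rw [norm_div]
  refine div_le_one_of_le₀ ?_ (norm_nonneg _)
  rw [← sq_le_sq₀ (norm_nonneg _) (norm_nonneg _)]
  have ha' : ‖a‖ ^ 2 ≤ 1 := pow_le_one₀ (norm_nonneg _) ha.le
  have hb' : ‖b‖ ^ 2 ≤ 1 := pow_le_one₀ (norm_nonneg _) hb.le
  simp only [← Complex.normSq_eq_norm_sq, Complex.normSq_apply, Complex.sub_re, Complex.sub_im,
    Complex.mul_re, Complex.mul_im, Complex.conj_re, Complex.conj_im, Complex.one_re,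
    Complex.one_im] at *
  nlinarith [mul_nonneg (sub_nonneg.2 ha') (sub_nonneg.2 hb')]

theorem norm_le_one_of_mem_universalTestFunctions {n : ℕ}
    {Ω : Set (EuclideanSpace ℂ (Fin n))} (w₀ : Ω) :
    ∀ ψ ∈ universalTestFunctions w₀, ∀ z, ‖ψ z‖ ≤ 1 := by
  rintro ψ ⟨f, -, hf, rfl⟩ z
  exact norm_moebius_le_one (hf w₀) (hf z)

/-- `h(z) = i b + ⟨γ, (1 + U ρ(E(z)*)) (1 - U ρ(E(z)*))⁻¹ γ⟩` for some real `b`, Hilbert space `X`,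
vector `γ`, unitary `U` and unital `*`-representation `ρ` of `C_b(Ψ)` on `X`, the inner product
`⟨u, v⟩` being linear in `u` and conjugate linear in `v`, that is, `inner ℂ v u`. -/
def HasHerglotzRepresentation {S : Type*} (Ψ : Set (S → ℂ))
    (hΨ : ∀ ψ ∈ Ψ, ∀ z, ‖ψ z‖ ≤ 1) (h : S → ℂ) : Prop :=
  ∃ (b : ℝ) (X : Type) (_ : NormedAddCommGroup X) (_ : InnerProductSpace ℂ X)
    (_ : CompleteSpace X) (U : unitary (X →L[ℂ] X)) (γ : X)
    (ρ : (Ψ →ᵇ ℂ) →⋆ₐ[ℂ] (X →L[ℂ] X)),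
    ∀ z : S,
      IsUnit (1 - (U : X →L[ℂ] X) * ρ (star (evalAt Ψ hΨ z))) ∧
      h z = Complex.I * b +
        inner ℂ
          (((1 + (U : X →L[ℂ] X) * ρ (star (evalAt Ψ hΨ z))) *
            Ring.inverse (1 - (U : X →L[ℂ] X) * ρ (star (evalAt Ψ hΨ z)))) γ)
          γ

end HerglotzRep

end

/-! A representation forces `Re h ≥ 0`: `T = U ρ(E(z)*)` is a contraction, and for `x = (1 - T)⁻¹ γ`
the real part of `⟨γ, (1 + T) x⟩` is `‖x‖² - ‖T x‖²`.

Conversely, for the universal family one test function suffices. If `Re h > 0`, then `f = (h -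
h(w₀)) / (h + conj h(w₀))` maps into the disc and vanishes at `w₀`, so `ψ = -f` is a test function,
and `h` is an affine function of `(1 - ψ) / (1 + ψ)`, represented on `ℂ` by evaluation at `ψ` and `U
= -1`. If `Re h` vanishes somewhere, `h` is an imaginary constant.

For a family with `SA_Ψ` equal to the Schur class, duality gives an Agler decomposition `h(z) + conj
h(w) = ⟨v z, v w⟩ - ⟨ρ(E(z)*) v z, ρ(E(w)*) v w⟩` (`exists_inner_sub_inner`, in Mathlib's order of
the inner product). On functions of `(ψ, x)`, send `conj x(z) (1 - ψ(z) conj ψ(w)) x(w)` to `h(z) +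
conj h(w)`. This is positive, because the Hermitian part of a coefficient family positive on these
functions is an admissible kernel (`re_sum_nonneg_of_mem_schurAglerClass`). The M. Riesz theorem
extends it (`exists_posFunctional`), and the GNS construction yields `ρ` and `v`.

Since `E(w₀) = 0`, the decomposition says that `ρ(E(z)*) v z ↦ v z - v w₀` preserves Gram matrices.
A unitary `U` on `X ⊕ X` extends this lurking isometry (`exists_unitary_map_eq`). Then `(1 - T) v z
= v w₀`, which inverts `1 - T` on the relevant vector and gives the formula. -/

namespace HerglotzRep

/-! ### Unitary extension of lurking isometries -/

section UnitaryExtension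

variable {X : Type*} [NormedAddCommGroup X] [InnerProductSpace ℂ X] [CompleteSpace X]

open ContinuousLinearMap in
/-- A partial isometry `C` is the upper left corner of a unitary operator on `X ⊕ X`. -/
theorem exists_unitary_of_partialIsometry (C : X →L[ℂ] X) (hC : C ∘L adjoint C ∘L C = C) :
    ∃ U : unitary (WithLp 2 (X × X) →L[ℂ] WithLp 2 (X × X)),
      ∀ x, (U : WithLp 2 (X × X) →L[ℂ] WithLp 2 (X × X)) (WithLp.toLp 2 (x, 0)) =
        WithLp.toLp 2 (C x, x - adjoint C (C x)) := by
  have h1 : ∀ x, C (adjoint C (C x)) = C x := fun x => congr($hC x)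
  have h2 : ∀ x, adjoint C (C (adjoint C x)) = adjoint C x := fun x =>
    ext_inner_right ℂ fun y => by simp only [adjoint_inner_left, ← adjoint_inner_right C, h1]
  have h3 : ∀ x y, inner ℂ (C (adjoint C x)) (C y) = inner ℂ x (C y) := fun x y => by
    rw [← adjoint_inner_left, h2, adjoint_inner_left]
  -- Halmos dilation, with rows `(C, 1 - CC*)` and `(1 - C*C, -C*)`. For a partial isometry the
  -- defect operators are projections, so no square roots are needed.
  let J (A : X →L[ℂ] X) : WithLp 2 (X × X) →ₗ[ℂ] WithLp 2 (X × X) :=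
    { toFun := fun p => WithLp.toLp 2
        (A p.fst + (p.snd - A (adjoint A p.snd)), p.fst - adjoint A (A p.fst) - adjoint A p.snd)
      map_add' := fun p q => by
        refine WithLp.ofLp_injective 2 (Prod.ext ?_ ?_) <;> simp <;> abel
      map_smul' := fun c p => by
        refine WithLp.ofLp_injective 2 (Prod.ext ?_ ?_) <;> simp [smul_sub] }
  let J' : WithLp 2 (X × X) →ₗ[ℂ] WithLp 2 (X × X) :=
    { toFun := fun p => WithLp.toLp 2
        (adjoint C p.fst + (p.snd - adjoint C (C p.snd)), p.fst - C (adjoint C p.fst) - C p.snd)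
      map_add' := fun p q => by
        refine WithLp.ofLp_injective 2 (Prod.ext ?_ ?_) <;> simp <;> abel
      map_smul' := fun c p => by
        refine WithLp.ofLp_injective 2 (Prod.ext ?_ ?_) <;> simp [smul_sub] }
  let e : WithLp 2 (X × X) ≃ₗ[ℂ] WithLp 2 (X × X) :=
    { J C with
      invFun := J'
      left_inv := fun p => by
        refine WithLp.ofLp_injective 2 (Prod.ext ?_ ?_) <;> simp [J, J', h1, h2]
      right_inv := fun p => by
        refine WithLp.ofLp_injective 2 (Prod.ext ?_ ?_) <;> simp [J, J', h1, h2] }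
  have he : ∀ p q, inner ℂ (e p) (e q) = inner ℂ p q := fun p q => by
    simp [e, J, WithLp.prod_inner_apply, inner_add_left, inner_add_right, inner_sub_left,
      inner_sub_right, ← adjoint_inner_left C, ← adjoint_inner_right C, h2]
    simp [adjoint_inner_left, adjoint_inner_right, h1, h3]
    ring
  refine ⟨Unitary.linearIsometryEquiv.symm
    ⟨e, fun p => (LinearMap.norm_map_iff_inner_map_map e).2 he p⟩, fun x => ?_⟩
  simp [e, J]

open ContinuousLinearMap in
/-- Two families with the same Gram matrix are related by a partial isometry. -/
theorem exists_partialIsometry {S : Type*} (a b : S → X)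
    (hab : ∀ s t, inner ℂ (a s) (a t) = inner ℂ (b s) (b t)) :
    ∃ C : X →L[ℂ] X, C ∘L adjoint C ∘L C = C ∧ ∀ s, C (a s) = b s ∧ adjoint C (C (a s)) = a s := by
  let A := Finsupp.linearCombination ℂ a
  let B := Finsupp.linearCombination ℂ b
  have hAB : ∀ c d, inner ℂ (A c) (A d) = inner ℂ (B c) (B d) := fun c d => by
    simp [A, B, Finsupp.linearCombination_apply, Finsupp.sum_inner, Finsupp.inner_sum, hab]
  let M : Submodule ℂ X := (LinearMap.range A).topologicalClosure
  have : CompleteSpace M := (Submodule.isClosed_topologicalClosure _).completeSpace_coe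
  let e : (S →₀ ℂ) →ₗ[ℂ] M := A.codRestrict M fun c =>
    Submodule.le_topologicalClosure _ (LinearMap.mem_range_self A c)
  have hd : DenseRange e := by
    intro x
    rw [Topology.IsInducing.subtypeVal.closure_eq_preimage_closure_image]
    have : ((Subtype.val : M → X) '' Set.range e) = LinearMap.range A := by
      ext y
      simp [e]
    rw [Set.mem_preimage]
    erw [this]
    exact x.2
  -- Equal Gram matrices make `∑ c a ↦ ∑ c b` well defined and isometric, so it extends to the
  -- closed span `M`; composed with the projection onto `M` it is a partial isometry.
  have hn : ∀ c, ‖B c‖ ≤ 1 * ‖e c‖ := fun c => by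
    rw [one_mul]
    refine le_of_eq ?_
    change ‖B c‖ = ‖A c‖
    rw [@norm_eq_sqrt_re_inner ℂ, @norm_eq_sqrt_re_inner ℂ _ _ _ _ (A c), hAB]
  let V : M →L[ℂ] X := B.extendOfNorm e
  have hV : ∀ c, V (e c) = B c := B.extendOfNorm_eq hd ⟨1, hn⟩
  have hVV : ∀ x y, inner ℂ (V x) (V y) = inner ℂ x y := fun x y => by
    refine hd.induction_on₂ (p := fun x y => inner ℂ (V x) (V y) = inner ℂ x y) ?_ ?_ x y
    · exact isClosed_eq (by fun_prop) (by fun_prop)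
    · intro c d
      rw [hV, hV, ← hAB]
      rfl
  let P := M.orthogonalProjectionOnto
  let C : X →L[ℂ] X := V ∘L P
  have hCC : ∀ x, adjoint C (C x) = P x := fun x => ext_inner_right ℂ fun y => by
    rw [adjoint_inner_left]
    change inner ℂ (V (P x)) (V (P y)) = _
    rw [hVV]
    exact M.inner_orthogonalProjectionOnto_eq_of_mem_left _ _
  have hPa : ∀ c, P (A c) = e c := fun c => M.orthogonalProjectionOnto_mem_subspace_eq_self (e c)
  have hP : ∀ s, P (a s) = e (Finsupp.single s 1) := fun s => by
    rw [← hPa]; simp [A]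
  refine ⟨C, ?_, fun s => ⟨?_, ?_⟩⟩
  · ext x
    change V (P (adjoint C (C x))) = V (P x)
    rw [hCC]
    congr 1
    exact M.orthogonalProjectionOnto_mem_subspace_eq_self (P x)
  · change V (P (a s)) = b s
    rw [hP, hV]; simp [B]
  · rw [hCC, hP]
    simp [e, A]

/-- Two families with the same Gram matrix are related by a unitary operator on `X ⊕ X`. -/
theorem exists_unitary_map_eq {S : Type*} (a b : S → X)
    (hab : ∀ s t, inner ℂ (a s) (a t) = inner ℂ (b s) (b t)) :
    ∃ U : unitary (WithLp 2 (X × X) →L[ℂ] WithLp 2 (X × X)),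
      ∀ s, (U : WithLp 2 (X × X) →L[ℂ] WithLp 2 (X × X)) (WithLp.toLp 2 (a s, 0)) =
        WithLp.toLp 2 (b s, 0) := by
  obtain ⟨C, hC, h⟩ := exists_partialIsometry a b hab
  obtain ⟨U, hU⟩ := exists_unitary_of_partialIsometry C hC
  exact ⟨U, fun s => by rw [hU, (h s).2, (h s).1, sub_self]⟩

/-- The direct sum of a representation with itself. -/
noncomputable def doubleRep {A : Type*} [Semiring A] [Algebra ℂ A] [Star A]
    (ρ : A →⋆ₐ[ℂ] (X →L[ℂ] X)) :
    A →⋆ₐ[ℂ] (WithLp 2 (X × X) →L[ℂ] WithLp 2 (X × X)) where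
  toFun t := ((WithLp.prodContinuousLinearEquiv 2 ℂ X X).symm : X × X →L[ℂ] WithLp 2 (X × X)) ∘L
    ((ρ t).prodMap (ρ t)) ∘L
    (WithLp.prodContinuousLinearEquiv 2 ℂ X X : WithLp 2 (X × X) →L[ℂ] X × X)
  map_one' := by ext p; refine WithLp.ofLp_injective 2 (Prod.ext ?_ ?_) <;> simp
  map_mul' s t := by ext p; refine WithLp.ofLp_injective 2 (Prod.ext ?_ ?_) <;> simp
  map_zero' := by ext p; refine WithLp.ofLp_injective 2 (Prod.ext ?_ ?_) <;> simp
  map_add' s t := by ext p; refine WithLp.ofLp_injective 2 (Prod.ext ?_ ?_) <;> simp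
  commutes' r := by
    ext p
    refine WithLp.ofLp_injective 2 (Prod.ext ?_ ?_) <;> simp [Algebra.algebraMap_eq_smul_one]
  map_star' t := by
    refine (ContinuousLinearMap.eq_adjoint_iff _ _).2 fun p q => ?_
    simp [WithLp.prod_inner_apply, map_star, ContinuousLinearMap.star_eq_adjoint,
      ContinuousLinearMap.adjoint_inner_left]

@[simp]
theorem doubleRep_apply {A : Type*} [Semiring A] [Algebra ℂ A] [Star A]
    (ρ : A →⋆ₐ[ℂ] (X →L[ℂ] X)) (t : A) (p : X × X) :
    doubleRep ρ t (WithLp.toLp 2 p) = WithLp.toLp 2 (ρ t p.1, ρ t p.2) := rfl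

end UnitaryExtension

end HerglotzRep

namespace HerglotzRep

/-! ### Positive functionals and the GNS construction -/

section PositiveFunctionals

open scoped NNReal

variable {Y : Type*} (D : Submodule ℝ≥0 (Y → ℝ))

/-- The functions whose modulus is bounded by a member of `D`. -/
def dominated : Submodule ℂ (Y → ℂ) where
  carrier := {φ | ∃ d ∈ D, ∀ y, ‖φ y‖ ≤ d y}
  add_mem' := by
    rintro φ χ ⟨d, hd, h⟩ ⟨d', hd', h'⟩
    exact ⟨d + d', D.add_mem hd hd', fun y => (norm_add_le _ _).trans (add_le_add (h y) (h' y))⟩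
  zero_mem' := ⟨0, D.zero_mem, fun y => by simp⟩
  smul_mem' := by
    rintro c φ ⟨d, hd, h⟩
    refine ⟨‖c‖₊ • d, D.smul_mem _ hd, fun y => ?_⟩
    simpa [NNReal.smul_def] using mul_le_mul_of_nonneg_left (h y) (norm_nonneg c)

/-- The functions whose squared modulus is bounded by a member of `D`. -/
def sqDominated : Submodule ℂ (Y → ℂ) where
  carrier := {φ | ∃ d ∈ D, ∀ y, ‖φ y‖ ^ 2 ≤ d y}
  add_mem' := by
    rintro φ χ ⟨d, hd, h⟩ ⟨d', hd', h'⟩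
    refine ⟨(2 : ℝ≥0) • (d + d'), D.smul_mem _ (D.add_mem hd hd'), fun y => ?_⟩
    have h1 : ‖φ y + χ y‖ ^ 2 ≤ (‖φ y‖ + ‖χ y‖) ^ 2 := by gcongr; exact norm_add_le _ _
    have h2 := h y
    have h3 := h' y
    simp only [Pi.add_apply, Pi.smul_apply, NNReal.smul_def, smul_eq_mul, NNReal.coe_ofNat]
    nlinarith [sq_nonneg (‖φ y‖ - ‖χ y‖)]
  zero_mem' := ⟨0, D.zero_mem, fun y => by simp⟩
  smul_mem' := by
    rintro c φ ⟨d, hd, h⟩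
    refine ⟨(‖c‖₊ ^ 2) • d, D.smul_mem _ hd, fun y => ?_⟩
    simpa [NNReal.smul_def, mul_pow] using mul_le_mul_of_nonneg_left (h y) (sq_nonneg ‖c‖)

/-- Linear functionals on the dominated functions that are nonnegative, in real part, on functions
with nonnegative real part. -/
structure PosFunctional where
  /-- The underlying linear functional. -/
  toLinearMap : dominated D →ₗ[ℂ] ℂ
  /-- Positivity. -/
  re_nonneg : ∀ φ : dominated D, (∀ y, 0 ≤ (φ.1 y).re) → 0 ≤ (toLinearMap φ).re

variable {D}

/-- A functional on a family of dominated functions extends to a positive functional if it is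
positive on the family and the family is cofinal. -/
theorem exists_posFunctional {K : Type*} [AddCommGroup K] [Module ℂ K]
    (T : K →ₗ[ℂ] dominated D) (ℓ : K →ₗ[ℂ] ℂ)
    (hpos : ∀ c, (∀ y, 0 ≤ ((T c).1 y).re) → 0 ≤ (ℓ c).re)
    (hdom : ∀ d ∈ D, ∃ c, ∀ y, d y ≤ ((T c).1 y).re) :
    ∃ L : PosFunctional D, ∀ c, L.toLinearMap (T c) = ℓ c := by
  let P : PointedCone ℝ (dominated D) :=
    { carrier := {φ | ∀ y, 0 ≤ (φ.1 y).re}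
      add_mem' := fun {φ χ} h h' y => by simpa using add_nonneg (h y) (h' y)
      zero_mem' := fun y => by simp
      smul_mem' := fun c φ h y => by
        change 0 ≤ ((((c : ℝ) • φ.1 : Y → ℂ)) y).re
        rw [Pi.smul_apply, Complex.smul_re]
        exact mul_nonneg c.2 (h y) }
  let T' : K →ₗ[ℝ] dominated D := T.restrictScalars ℝ
  let ℓ' : K →ₗ[ℝ] ℝ := Complex.reLm ∘ₗ ℓ.restrictScalars ℝ
  -- Positivity at both `c` and `-c` kills `ℓ'` on the kernel of `T`, so `ℓ'` factors through `T`.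
  have hker : ℓ' ∈ LinearMap.range T'.dualMap := by
    rw [LinearMap.range_dualMap_eq_dualAnnihilator_ker, Submodule.mem_dualAnnihilator]
    intro c hc
    have hc : T c = 0 := hc
    have h1 := hpos c (by simp [hc])
    have h2 := hpos (-c) (by simp [hc])
    simp only [map_neg, Complex.neg_re] at h2
    change (ℓ c).re = 0
    linarith
  obtain ⟨g₀, hg₀⟩ := hker
  have hg₀ : ∀ c, g₀ (T c) = (ℓ c).re := fun c => congr($hg₀ c)
  obtain ⟨g, hg, hgP⟩ := riesz_extension P ⟨LinearMap.range T', g₀ ∘ₗ (LinearMap.range T').subtype⟩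
    (by
      rintro ⟨_, c, rfl⟩ hc
      change 0 ≤ g₀ (T c)
      rw [hg₀]
      exact hpos c hc)
    (by
      rintro ⟨φ, d, hd, h⟩
      obtain ⟨c, hc⟩ := hdom d hd
      refine ⟨⟨T c, LinearMap.mem_range_self T' c⟩, fun y => ?_⟩
      have h1 := (abs_le.1 ((Complex.abs_re_le_norm (φ y)).trans ((h y).trans (hc y)))).1
      change 0 ≤ ((T c).1 y + φ y).re
      rw [Complex.add_re]
      linarith)
  have hgT : ∀ c, g (T c) = (ℓ c).re := fun c =>
    (hg ⟨T c, LinearMap.mem_range_self T' c⟩).trans (hg₀ c)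
  -- The real functional `g` is the real part of the complex functional `φ ↦ g φ - i g (i φ)`.
  have hre : ∀ φ, (Module.Dual.extendRCLike (𝕜 := ℂ) g φ).re = g φ :=
    Module.Dual.re_extendRCLike_apply (𝕜 := ℂ) g
  have him : ∀ φ, (Module.Dual.extendRCLike (𝕜 := ℂ) g φ).im = -g (Complex.I • φ) :=
    Module.Dual.im_extendRCLike_apply (𝕜 := ℂ) g
  refine ⟨⟨Module.Dual.extendRCLike (𝕜 := ℂ) g, fun φ hφ => ?_⟩, fun c => Complex.ext ?_ ?_⟩
  · rw [hre]
    exact hgP φ hφ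
  · rw [hre, hgT]
  · rw [him, ← map_smul, hgT]
    simp

namespace PosFunctional

variable (L : PosFunctional D)

/-- The function `conj φ * χ` as a dominated function. -/
def conjMul (φ χ : sqDominated D) : dominated D :=
  ⟨fun y => conj (φ.1 y) * χ.1 y, by
    obtain ⟨d, hd, h⟩ := φ.2
    obtain ⟨d', hd', h'⟩ := χ.2
    refine ⟨d + d', D.add_mem hd hd', fun y => ?_⟩
    have h2 := h y
    have h3 := h' y
    simp only [norm_mul, Pi.add_apply, RCLike.norm_conj]
    nlinarith [sq_nonneg (‖φ.1 y‖ - ‖χ.1 y‖), sq_nonneg (‖φ.1 y‖ + ‖χ.1 y‖)]⟩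

theorem map_mono {φ χ : dominated D} (h : ∀ y, (φ.1 y).re ≤ (χ.1 y).re) :
    (L.toLinearMap φ).re ≤ (L.toLinearMap χ).re := by
  have := L.re_nonneg (χ - φ) fun y => by simpa using h y
  simpa using this

/-- Functions with equal real parts have images with equal real parts. This applies to `φ, χ` and to
`iφ, -iχ`, the latter controlling imaginary parts. It supplies the Hermitian symmetry of the GNS
form. -/
theorem map_conj {φ χ : dominated D} (h : ∀ y, χ.1 y = conj (φ.1 y)) :
    L.toLinearMap χ = conj (L.toLinearMap φ) := by
  refine Complex.ext ?_ ?_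
  · exact le_antisymm (L.map_mono fun y => by simp [h]) (L.map_mono fun y => by simp [h])
  · have h1 := L.map_mono (φ := Complex.I • φ) (χ := -(Complex.I • χ)) fun y => by simp [h]
    have h2 := L.map_mono (χ := Complex.I • φ) (φ := -(Complex.I • χ)) fun y => by simp [h]
    simp at h1 h2 ⊢
    linarith

/-- The space of square dominated functions, with the semi-inner product `L (conj φ * χ)`. -/
def PreL2 (_L : PosFunctional D) : Type _ := sqDominated D

instance : AddCommGroup L.PreL2 := inferInstanceAs (AddCommGroup (sqDominated D))
instance : Module ℂ L.PreL2 := inferInstanceAs (Module ℂ (sqDominated D))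

/-- The identification of the square dominated functions with `PreL2`. -/
def toPreL2 : sqDominated D ≃ₗ[ℂ] L.PreL2 := LinearEquiv.refl ℂ _

/-- The semi-inner product of `PreL2`. -/
noncomputable abbrev preL2Core : PreInnerProductSpace.Core ℂ L.PreL2 where
  inner φ χ := L.toLinearMap (conjMul (L.toPreL2.symm φ) (L.toPreL2.symm χ))
  conj_inner_symm φ χ := (L.map_conj fun y => by simp [conjMul, mul_comm]).symm
  re_inner_nonneg φ := L.re_nonneg _ fun y => by
    simp only [conjMul, ← Complex.normSq_eq_conj_mul_self, Complex.ofReal_re]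
    exact Complex.normSq_nonneg _
  add_left φ χ ω := by
    rw [← map_add]
    congr 1
    ext y
    simp [conjMul, add_mul]
  smul_left φ χ c := by
    rw [← smul_eq_mul, ← map_smul]
    congr 1
    ext y
    simp [conjMul, mul_assoc]

noncomputable instance : SeminormedAddCommGroup L.PreL2 :=
  InnerProductSpace.Core.toSeminormedAddCommGroup (c := L.preL2Core)

noncomputable instance : InnerProductSpace ℂ L.PreL2 :=
  InnerProductSpace.ofCore L.preL2Core

theorem preL2_inner_def (φ χ : L.PreL2) :
    inner ℂ φ χ = L.toLinearMap (conjMul (L.toPreL2.symm φ) (L.toPreL2.symm χ)) := rfl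

theorem preL2_norm_sq (φ : L.PreL2) :
    ‖φ‖ ^ 2 = (L.toLinearMap (conjMul (L.toPreL2.symm φ) (L.toPreL2.symm φ))).re := by
  rw [← preL2_inner_def]
  exact norm_sq_eq_re_inner (𝕜 := ℂ) φ

/-- The Hilbert space of a positive functional. -/
abbrev L2 := UniformSpace.Completion L.PreL2

variable {Ψ : Type*} [TopologicalSpace Ψ] (π : Y → Ψ)

/-- Multiplication of a square dominated function by a bounded function. -/
noncomputable def mulSq (t : Ψ →ᵇ ℂ) : sqDominated D →ₗ[ℂ] sqDominated D where
  toFun φ := ⟨fun y => t (π y) * φ.1 y, by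
    obtain ⟨d, hd, h⟩ := φ.2
    refine ⟨(‖t‖₊ ^ 2) • d, D.smul_mem _ hd, fun y => ?_⟩
    have h1 : ‖t (π y)‖ ^ 2 ≤ ‖t‖ ^ 2 := by gcongr; exact t.norm_coe_le_norm _
    simpa [NNReal.smul_def, mul_pow] using
      mul_le_mul h1 (h y) (sq_nonneg _) (sq_nonneg _)⟩
  map_add' φ χ := by ext y; simp [mul_add]
  map_smul' c φ := by ext y; simp [mul_left_comm]

/-- Multiplication by a bounded function on `PreL2`. -/
noncomputable def mulPreL2 (t : Ψ →ᵇ ℂ) : L.PreL2 →L[ℂ] L.PreL2 :=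
  (L.toPreL2.toLinearMap ∘ₗ mulSq π t ∘ₗ L.toPreL2.symm.toLinearMap).mkContinuous ‖t‖ fun φ => by
    rw [← sq_le_sq₀ (norm_nonneg _) (by positivity), mul_pow, preL2_norm_sq, preL2_norm_sq,
      ← Complex.re_ofReal_mul, ← smul_eq_mul, ← map_smul]
    refine L.map_mono fun y => ?_
    have h1 : ‖t (π y)‖ ^ 2 ≤ ‖t‖ ^ 2 := by gcongr; exact t.norm_coe_le_norm _
    have h2 := mul_le_mul_of_nonneg_right h1 (sq_nonneg ‖(L.toPreL2.symm φ).1 y‖)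
    have h3 : ∀ z : ℂ, conj z * z = ((‖z‖ ^ 2 : ℝ) : ℂ) := fun z => by
      rw [← Complex.normSq_eq_conj_mul_self, Complex.normSq_eq_norm_sq]
    change (conj (t (π y) * (L.toPreL2.symm φ).1 y) * (t (π y) * (L.toPreL2.symm φ).1 y)).re ≤
      (((‖t‖ ^ 2 : ℝ) : ℂ) * (conj ((L.toPreL2.symm φ).1 y) * (L.toPreL2.symm φ).1 y)).re
    rw [h3, h3, ← Complex.ofReal_mul, Complex.ofReal_re, Complex.ofReal_re, norm_mul, mul_pow]
    exact h2

theorem mulPreL2_apply (t : Ψ →ᵇ ℂ) (φ : sqDominated D) :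
    L.mulPreL2 π t (L.toPreL2 φ) = L.toPreL2 (mulSq π t φ) := rfl

open UniformSpace.Completion in
/-- Bounded functions act on the Hilbert space of a positive functional by multiplication. -/
noncomputable def mulRep : (Ψ →ᵇ ℂ) →⋆ₐ[ℂ] (L.L2 →L[ℂ] L.L2) :=
  have key {T : L.L2 →L[ℂ] L.L2} {T' : L.L2 →L[ℂ] L.L2}
      (h : ∀ φ, T (L.toPreL2 φ : L.L2) = T' (L.toPreL2 φ : L.L2)) : T = T' := by
    ext x
    induction x using induction_on with
    | hp => exact isClosed_eq T.continuous T'.continuous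
    | ih x => exact h (L.toPreL2.symm x)
  { toFun := fun t => (L.mulPreL2 π t).completion
    map_one' := key fun φ => by
      simp only [ContinuousLinearMap.completion_apply_coe, mulPreL2_apply]
      congr 2
      ext y
      simp [mulSq]
    map_mul' := fun s t => key fun φ => by
      simp only [ContinuousLinearMap.completion_apply_coe, mulPreL2_apply,
        mul_apply_eq_comp]
      congr 2
      ext y
      simp [mulSq, mul_assoc]
    map_zero' := key fun φ => by
      simp only [ContinuousLinearMap.completion_apply_coe, mulPreL2_apply,
        _root_.zero_apply]
      rw [← coe_zero]
      congr 1
      refine (congrArg L.toPreL2 ?_).trans L.toPreL2.map_zero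
      ext y
      simp [mulSq]
    map_add' := fun s t => key fun φ => by
      simp only [ContinuousLinearMap.completion_apply_coe, mulPreL2_apply,
        _root_.add_apply]
      rw [← coe_add, ← map_add]
      congr 2
      ext y
      simp [mulSq, add_mul]
    commutes' := fun r => key fun φ => by
      simp only [ContinuousLinearMap.completion_apply_coe, mulPreL2_apply,
        Algebra.algebraMap_eq_smul_one, _root_.smul_apply,
        one_apply_eq_self]
      rw [← coe_smul, ← map_smul]
      congr 2
      ext y
      simp [mulSq]
    map_star' := fun t => by
      refine (ContinuousLinearMap.eq_adjoint_iff _ _).2 fun x y => ?_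
      induction x, y using induction_on₂ with
      | hp => apply isClosed_eq <;> fun_prop
      | ih x y =>
        simp only [ContinuousLinearMap.completion_apply_coe, inner_coe]
        change L.toLinearMap _ = L.toLinearMap _
        congr 1
        ext y
        simp [conjMul, mulPreL2, mulSq]
        ring }

theorem mulRep_apply (t : Ψ →ᵇ ℂ) (φ : sqDominated D) :
    L.mulRep π t (L.toPreL2 φ : L.L2) = (L.toPreL2 (mulSq π t φ) : L.L2) :=
  ContinuousLinearMap.completion_apply_coe _ _

theorem inner_coe_toPreL2 (φ χ : sqDominated D) :
    inner ℂ (L.toPreL2 φ : L.L2) (L.toPreL2 χ : L.L2) = L.toLinearMap (conjMul φ χ) :=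
  UniformSpace.Completion.inner_coe _ _

end PosFunctional

end PositiveFunctionals

end HerglotzRep

namespace HerglotzRep

/-! ### Positive kernels and Schur-Agler duality -/

section Kernels

variable {S : Type*}

/-- Any support can be enlarged by zero coefficients to contain `F₀`, and Hermitian symmetry makes
the form real. -/
theorem isPSDKernel_of_re_nonneg {k : S → S → ℂ} (hk : ∀ z w, conj (k w z) = k z w)
    (F₀ : Finset S)
    (h : ∀ F, F₀ ⊆ F → ∀ x : S → ℂ, 0 ≤ (∑ z ∈ F, ∑ w ∈ F, conj (x z) * k z w * x w).re) :
    IsPSDKernel k := by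
  classical
  refine ⟨Matrix.ext fun z w => hk z w, fun x => ?_⟩
  have hs : (x.sum fun i xi => x.sum fun j xj => star xi * Matrix.of k i j * xj) =
      ∑ z ∈ F₀ ∪ x.support, ∑ w ∈ F₀ ∪ x.support, conj (x z) * k z w * x w := by
    rw [Finsupp.sum_of_support_subset x Finset.subset_union_right _ (by simp)]
    refine Finset.sum_congr rfl fun z _ => ?_
    rw [Finsupp.sum_of_support_subset x Finset.subset_union_right _ (by simp)]
    rfl
  rw [hs]
  set q := ∑ z ∈ F₀ ∪ x.support, ∑ w ∈ F₀ ∪ x.support, conj (x z) * k z w * x w with hq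
  have hc : conj q = q := by
    rw [hq]
    conv_lhs => rw [Finset.sum_comm]
    simp only [map_sum, map_mul, Complex.conj_conj, hk]
    exact Finset.sum_congr rfl fun z _ => Finset.sum_congr rfl fun w _ => by ring
  rw [← Complex.conj_eq_iff_re.1 hc]
  exact_mod_cast h _ Finset.subset_union_left x

theorem IsPSDKernel.re_nonneg {k : S → S → ℂ} (h : IsPSDKernel k) (F : Finset S) (x : S → ℂ) :
    0 ≤ (∑ z ∈ F, ∑ w ∈ F, conj (x z) * k z w * x w).re := by
  classical
  let y : S →₀ ℂ := Finsupp.onFinset F (fun z => if z ∈ F then x z else 0) (by simp; tauto)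
  have hy := h.2 y
  have hyF : y.support ⊆ F := Finsupp.support_onFinset_subset
  have hs : (y.sum fun i xi => y.sum fun j xj => star xi * Matrix.of k i j * xj) =
      ∑ z ∈ F, ∑ w ∈ F, conj (x z) * k z w * x w := by
    rw [Finsupp.sum_of_support_subset y hyF _ (by simp)]
    refine Finset.sum_congr rfl fun z hz => ?_
    rw [Finsupp.sum_of_support_subset y hyF _ (by simp)]
    refine Finset.sum_congr rfl fun w hw => ?_
    simp [y, hz, hw]
  rw [hs] at hy
  exact (Complex.le_def.1 hy).1

/-- If `(1 - ψ(z) conj ψ(w)) k(z, w)` has a positive semidefinite form on `F` and `|ψ| < 1`, so has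
`k`. -/
theorem re_nonneg_of_one_sub_mul {k : S → S → ℂ} {ψ : S → ℂ} (hψ : ∀ z, ‖ψ z‖ < 1) (F : Finset S)
    (h : ∀ x : S → ℂ, 0 ≤ (∑ z ∈ F, ∑ w ∈ F,
      conj (x z) * ((1 - ψ z * conj (ψ w)) * k z w) * x w).re) (x : S → ℂ) :
    0 ≤ (∑ z ∈ F, ∑ w ∈ F, conj (x z) * k z w * x w).re := by
  let q (x : S → ℂ) : ℝ := (∑ z ∈ F, ∑ w ∈ F, conj (x z) * k z w * x w).re
  -- The hypothesis says that multiplying `x` by `conj ψ` does not increase `q`. Iterating drives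
  -- the vector to `0`, whence `q x ≥ q 0 = 0`.
  have hq : ∀ x : S → ℂ, q (fun z => conj (ψ z) * x z) ≤ q x := fun x => by
    rw [← sub_nonneg, ← Complex.sub_re, ← Finset.sum_sub_distrib]
    convert h x using 3 with z hz
    rw [← Finset.sum_sub_distrib]
    refine Finset.sum_congr rfl fun w _ => ?_
    simp only [map_mul, Complex.conj_conj]
    ring
  have hn : ∀ n : ℕ, q (fun z => conj (ψ z) ^ n * x z) ≤ q x := fun n => by
    induction n with
    | zero => simp
    | succ n ih =>
      refine le_trans (le_of_eq_of_le ?_ (hq _)) ih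
      congr 1
      ext z
      ring
  have hcont : Continuous q := by fun_prop
  have hlim : Filter.Tendsto (fun n : ℕ => q (fun z => conj (ψ z) ^ n * x z)) Filter.atTop
      (nhds (q 0)) := by
    refine (hcont.tendsto 0).comp (tendsto_pi_nhds.2 fun z => ?_)
    have := (tendsto_pow_atTop_nhds_zero_of_norm_lt_one (x := conj (ψ z))
      (by simpa using hψ z)).mul_const (x z)
    simpa using this
  have h0 : q 0 = 0 := by simp [q]
  rw [← h0]
  exact le_of_tendsto' hlim hn

theorem _root_.Finsupp.sum_eq_sum_sum {c : S × S →₀ ℂ} {F : Finset S} (hF : c.support ⊆ F ×ˢ F)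
    (g : S × S → ℂ) : (c.sum fun p t => t * g p) = ∑ z ∈ F, ∑ w ∈ F, c (z, w) * g (z, w) := by
  rw [Finsupp.sum_of_support_subset c hF _ (by simp), Finset.sum_product]

/-- Pairing with a Hermitian kernel sees only the Hermitian part of `c`; this turns arbitrary
coefficients into a Hermitian kernel. -/
theorem re_sum_add_conj (F : Finset S) (c g : S → S → ℂ) (hg : ∀ z w, conj (g w z) = g z w) :
    (∑ z ∈ F, ∑ w ∈ F, (c z w + conj (c w z)) * g z w).re =
      2 * (∑ z ∈ F, ∑ w ∈ F, c z w * g z w).re := by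
  have : ∑ z ∈ F, ∑ w ∈ F, conj (c w z) * g z w = conj (∑ z ∈ F, ∑ w ∈ F, c z w * g z w) := by
    rw [Finset.sum_comm]
    simp only [map_sum, map_mul]
    exact Finset.sum_congr rfl fun z _ => Finset.sum_congr rfl fun w _ => by rw [hg]
  simp only [add_mul, Finset.sum_add_distrib]
  rw [this, Complex.add_re, Complex.conj_re]
  ring

/-- A finitely supported coefficient family which is positive on the kernels
`1 - ψ(z) conj ψ(w)` is positive on `h(z) + conj h(w)`, if the Cayley transform of `h` is in the
Schur-Agler class. -/
theorem re_sum_nonneg_of_mem_schurAglerClass {Ψ : Set (S → ℂ)} (hne : Ψ.Nonempty)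
    (hΨ : ∀ ψ ∈ Ψ, ∀ z, ‖ψ z‖ < 1) {h : S → ℂ} (hre : ∀ z, 0 ≤ (h z).re)
    (hSA : (fun z => (h z - 1) / (h z + 1)) ∈ schurAglerClass Ψ) (c : S × S →₀ ℂ)
    (hc : ∀ ψ ∈ Ψ, ∀ x : S → ℂ,
      0 ≤ (c.sum fun p t => t * (conj (x p.1) * (1 - ψ p.1 * conj (ψ p.2)) * x p.2)).re) :
    0 ≤ (c.sum fun p t => t * (h p.1 + conj (h p.2))).re := by
  classical
  let F₀ : Finset S := c.support.image Prod.fst ∪ c.support.image Prod.snd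
  have hF₀ : c.support ⊆ F₀ ×ˢ F₀ := fun p hp => Finset.mem_product.2
    ⟨Finset.mem_union_left _ (Finset.mem_image_of_mem _ hp),
      Finset.mem_union_right _ (Finset.mem_image_of_mem _ hp)⟩
  let k : S → S → ℂ := fun z w => c (z, w) + conj (c (w, z))
  have hk : ∀ z w, conj (k w z) = k z w := fun z w => by simp [k, add_comm]
  have hψk : ∀ ψ ∈ Ψ, ∀ F, F₀ ⊆ F → ∀ x : S → ℂ, 0 ≤ (∑ z ∈ F, ∑ w ∈ F,
      conj (x z) * ((1 - ψ z * conj (ψ w)) * k z w) * x w).re := fun ψ hψ F hF x => by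
    have h1 := hc ψ hψ x
    rw [Finsupp.sum_eq_sum_sum (hF₀.trans (Finset.product_subset_product hF hF))
      (fun p => conj (x p.1) * (1 - ψ p.1 * conj (ψ p.2)) * x p.2)] at h1
    have h2 := re_sum_add_conj F (fun z w => c (z, w))
      (fun z w => conj (x z) * (1 - ψ z * conj (ψ w)) * x w) fun z w => by simp; ring
    have h3 : ∑ z ∈ F, ∑ w ∈ F, conj (x z) * ((1 - ψ z * conj (ψ w)) * k z w) * x w =
        ∑ z ∈ F, ∑ w ∈ F, (c (z, w) + conj (c (w, z))) *
          (conj (x z) * (1 - ψ z * conj (ψ w)) * x w) :=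
      Finset.sum_congr rfl fun z _ => Finset.sum_congr rfl fun w _ => by simp only [k]; ring
    rw [h3, h2]
    exact mul_nonneg zero_le_two h1
  -- Positivity of `k` itself is recovered from a single `ψ`, which is why `Ψ` must be nonempty.
  have hadm : IsAdmissible Ψ k := by
    refine ⟨?_, fun ψ hψ => isPSDKernel_of_re_nonneg (fun z w => ?_) F₀ (hψk ψ hψ)⟩
    · obtain ⟨ψ, hψ⟩ := hne
      exact isPSDKernel_of_re_nonneg hk F₀ fun F hF =>
        re_nonneg_of_one_sub_mul (hΨ ψ hψ) F (hψk ψ hψ F hF)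
    · simp only [map_mul, hk]
      simp [mul_comm]
  -- This vector clears denominators: `(a + 1)(conj b + 1) - (a - 1)(conj b - 1) = 2 (a + conj b)`.
  have h1 := (hSA k hadm).re_nonneg F₀ fun z => conj (h z + 1)
  have hne : ∀ z, h z + 1 ≠ 0 := fun z h0 => by
    have := congrArg Complex.re h0
    simp at this
    linarith [hre z]
  have h2 : ∑ z ∈ F₀, ∑ w ∈ F₀, conj (conj (h z + 1)) *
      ((1 - (h z - 1) / (h z + 1) * conj ((h w - 1) / (h w + 1))) * k z w) * conj (h w + 1) =
      ∑ z ∈ F₀, ∑ w ∈ F₀, (c (z, w) + conj (c (w, z))) * (2 * (h z + conj (h w))) := by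
    refine Finset.sum_congr rfl fun z _ => Finset.sum_congr rfl fun w _ => ?_
    have hw : conj (h w) + 1 ≠ 0 := by simpa using (map_ne_zero (starRingEnd ℂ)).2 (hne w)
    have hz := hne z
    simp only [k, Complex.conj_conj, map_div₀, map_sub, map_add, map_one]
    field_simp
    ring
  rw [h2, re_sum_add_conj F₀ (fun z w => c (z, w)) (fun z w => 2 * (h z + conj (h w)))
    fun z w => by simp [Complex.conj_ofNat, add_comm]] at h1
  rw [Finsupp.sum_eq_sum_sum hF₀ fun p => h p.1 + conj (h p.2)]
  have h3 : ∑ z ∈ F₀, ∑ w ∈ F₀, c (z, w) * (2 * (h z + conj (h w))) =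
      2 * ∑ z ∈ F₀, ∑ w ∈ F₀, c (z, w) * (h z + conj (h w)) := by
    simp only [Finset.mul_sum]
    exact Finset.sum_congr rfl fun z _ => Finset.sum_congr rfl fun w _ => by ring
  rw [h3] at h1
  simp only [Complex.mul_re, Complex.re_ofNat, Complex.im_ofNat, zero_mul, sub_zero] at h1
  linarith

end Kernels

end HerglotzRep

namespace HerglotzRep

/-! ### Herglotz representations -/

section Representation

variable {S : Type*} {Ψ : Set (S → ℂ)} {hΨ : ∀ ψ ∈ Ψ, ∀ z, ‖ψ z‖ ≤ 1}

/-- A function with a Herglotz representation has nonnegative real part. -/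
theorem HasHerglotzRepresentation.re_nonneg {h : S → ℂ} (H : HasHerglotzRepresentation Ψ hΨ h)
    (z : S) : 0 ≤ (h z).re := by
  obtain ⟨b, X, _, _, _, U, γ, ρ, H⟩ := H
  obtain ⟨hu, hz⟩ := H z
  set T : X →L[ℂ] X := (U : X →L[ℂ] X) * ρ (star (evalAt Ψ hΨ z)) with hT
  have hTn : ∀ x, ‖T x‖ ≤ ‖x‖ := fun x => by
    rw [hT, mul_apply_eq_comp, Unitary.norm_map]
    refine (ContinuousLinearMap.le_of_opNorm_le _ (c := 1) ?_ x).trans_eq (one_mul _)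
    refine (NonUnitalStarAlgHom.norm_apply_le ρ _).trans ?_
    rw [norm_star]
    exact BoundedContinuousFunction.norm_ofNormedAddCommGroup_le _ zero_le_one _
  set x := Ring.inverse (1 - T) γ with hx
  have hγ : γ = x - T x := by
    have := congr($(Ring.mul_inverse_cancel _ hu) γ)
    simpa using this.symm
  have h1 : (inner ℂ (x + T x) (x - T x) : ℂ).re = ‖x‖ ^ 2 - ‖T x‖ ^ 2 := by
    have h2 : (inner ℂ (T x) x : ℂ).re = (inner ℂ x (T x) : ℂ).re := inner_re_symm (𝕜 := ℂ) _ _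
    have h3 : (inner ℂ x x : ℂ).re = ‖x‖ ^ 2 := (norm_sq_eq_re_inner (𝕜 := ℂ) x).symm
    have h4 : (inner ℂ (T x) (T x) : ℂ).re = ‖T x‖ ^ 2 :=
      (norm_sq_eq_re_inner (𝕜 := ℂ) (T x)).symm
    simp only [inner_add_left, inner_sub_right, Complex.add_re, Complex.sub_re, h2, h3, h4]
    ring
  have h5 : (inner ℂ (((1 + T) * Ring.inverse (1 - T)) γ) γ : ℂ) =
      inner ℂ (x + T x) (x - T x) := by
    rw [mul_apply_eq_comp, ← hx, ← hγ]
    rfl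
  rw [hz, h5, Complex.add_re, h1]
  have := pow_le_pow_left₀ (norm_nonneg _) (hTn x) 2
  simpa using this

/-- The Herglotz representation given by a single test function. -/
theorem hasHerglotzRepresentation_of_eq_div {ψ : S → ℂ} (hψ : ψ ∈ Ψ) (hψ1 : ∀ z, ‖ψ z‖ < 1)
    {h : S → ℂ} (b c : ℝ) (hc : 0 ≤ c)
    (hh : ∀ z, h z = Complex.I * b + c * ((1 - ψ z) / (1 + ψ z))) :
    HasHerglotzRepresentation Ψ hΨ h := by
  let χ : (Ψ →ᵇ ℂ) →⋆ₐ[ℂ] ℂ :=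
    { toFun := fun g => g ⟨ψ, hψ⟩
      map_one' := rfl
      map_mul' := fun _ _ => rfl
      map_zero' := rfl
      map_add' := fun _ _ => rfl
      commutes' := fun _ => rfl
      map_star' := fun _ => rfl }
  -- With `U = -1`, the operator `T` is the scalar `-conj (ψ z)`; the conjugate-linear slot turns
  -- `(1 - conj ψ) / (1 + conj ψ)` into `(1 - ψ) / (1 + ψ)`.
  refine ⟨b, ℂ, inferInstance, inferInstance, inferInstance, -1, (Real.sqrt c : ℂ),
    (StarAlgHom.ofId ℂ (ℂ →L[ℂ] ℂ)).comp χ, fun z => ?_⟩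
  have hne : 1 + ψ z ≠ 0 := fun h0 => by
    have h1 : ψ z = -1 := by linear_combination h0
    have := hψ1 z
    rw [h1] at this
    simp at this
  have hne' : 1 + conj (ψ z) ≠ 0 := by simpa using (map_ne_zero (starRingEnd ℂ)).2 hne
  have hT : ((-1 : unitary (ℂ →L[ℂ] ℂ)) : ℂ →L[ℂ] ℂ) *
      ((StarAlgHom.ofId ℂ (ℂ →L[ℂ] ℂ)).comp χ) (star (evalAt Ψ hΨ z)) =
      algebraMap ℂ (ℂ →L[ℂ] ℂ) (-conj (ψ z)) := by
    refine ContinuousLinearMap.ext fun x => ?_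
    rw [mul_apply_eq_comp, Unitary.coe_neg, OneMemClass.coe_one, _root_.neg_apply,
      one_apply_eq_self, Algebra.algebraMap_eq_smul_one, neg_smul, _root_.neg_apply]
    rfl
  have hsub : 1 - algebraMap ℂ (ℂ →L[ℂ] ℂ) (-conj (ψ z)) =
      algebraMap ℂ (ℂ →L[ℂ] ℂ) (1 + conj (ψ z)) := by
    rw [map_neg, map_add, map_one, sub_neg_eq_add]
  have hadd : 1 + algebraMap ℂ (ℂ →L[ℂ] ℂ) (-conj (ψ z)) =
      algebraMap ℂ (ℂ →L[ℂ] ℂ) (1 - conj (ψ z)) := by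
    rw [map_neg, map_sub, map_one, sub_eq_add_neg]
  have hu : IsUnit (algebraMap ℂ (ℂ →L[ℂ] ℂ) (1 + conj (ψ z))) := (IsUnit.mk0 _ hne').map _
  have hinv : Ring.inverse (algebraMap ℂ (ℂ →L[ℂ] ℂ) (1 + conj (ψ z))) =
      algebraMap ℂ (ℂ →L[ℂ] ℂ) (1 + conj (ψ z))⁻¹ := by
    refine hu.mul_left_cancel ?_
    rw [Ring.mul_inverse_cancel _ hu, ← map_mul, mul_inv_cancel₀ hne', map_one]
  have hs : (Real.sqrt c : ℂ) * Real.sqrt c = c := by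
    exact_mod_cast Real.mul_self_sqrt hc
  rw [hT, hsub, hadd, hinv, ← map_mul]
  refine ⟨hu, ?_⟩
  rw [hh z, Algebra.algebraMap_eq_smul_one, ← hs]
  simp
  field_simp

/-- The Herglotz representation obtained from a Gram representation of `h(z) + conj h(w)`. -/
theorem hasHerglotzRepresentation_of_inner_sub_inner {h : S → ℂ} (w₀ : S)
    (hw₀ : ∀ ψ ∈ Ψ, ψ w₀ = 0) (hsup : ∀ z, ∃ r : ℝ, r < 1 ∧ ∀ ψ ∈ Ψ, ‖ψ z‖ ≤ r)
    {X : Type} [NormedAddCommGroup X] [InnerProductSpace ℂ X] [CompleteSpace X]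
    (ρ : (Ψ →ᵇ ℂ) →⋆ₐ[ℂ] (X →L[ℂ] X)) (v : S → X)
    (hv : ∀ z w, inner ℂ (v z) (v w) - inner ℂ (ρ (star (evalAt Ψ hΨ z)) (v z))
      (ρ (star (evalAt Ψ hΨ w)) (v w)) = h z + conj (h w)) :
    HasHerglotzRepresentation Ψ hΨ h := by
  have hE0 : evalAt Ψ hΨ w₀ = 0 := by
    ext ψ
    exact hw₀ ψ ψ.2
  have hv0 : ∀ z, inner ℂ (v z) (v w₀) = h z + conj (h w₀) := fun z => by
    simpa [hE0] using hv z w₀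
  have hv0' : ∀ z, inner ℂ (v w₀) (v z) = h w₀ + conj (h z) := fun z => by
    simpa [hE0] using hv w₀ z
  obtain ⟨U, hU⟩ := exists_unitary_map_eq (fun z => ρ (star (evalAt Ψ hΨ z)) (v z))
    (fun z => v z - v w₀) fun z w => by
      have := hv z w
      simp only [inner_sub_left, inner_sub_right, hv0, hv0']
      linear_combination -this
  -- For `γ = s v(w₀)` the inner product is `½ ⟨2 v z - v w₀, v w₀⟩ = h z + conj (h w₀) - Re h(w₀)`,
  -- leaving exactly `b = Im h(w₀)`.
  let s : ℂ := ((Real.sqrt 2)⁻¹ : ℝ)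
  have hs : conj s * s = 1 / 2 := by
    simp only [s, Complex.conj_ofReal]
    rw [← Complex.ofReal_mul, ← mul_inv, Real.mul_self_sqrt zero_le_two]
    norm_num
  refine ⟨(h w₀).im, WithLp 2 (X × X), inferInstance, inferInstance, inferInstance, U,
    s • WithLp.toLp 2 (v w₀, 0), doubleRep ρ, fun z => ?_⟩
  set T := (U : WithLp 2 (X × X) →L[ℂ] WithLp 2 (X × X)) *
    doubleRep ρ (star (evalAt Ψ hΨ z)) with hT
  have hTv : T (WithLp.toLp 2 (v z, 0)) = WithLp.toLp 2 (v z - v w₀, 0) := by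
    rw [hT, mul_apply_eq_comp, doubleRep_apply, map_zero]
    exact hU z
  have hu : IsUnit (1 - T) := by
    refine isUnit_one_sub_of_norm_lt_one ?_
    obtain ⟨r, hr, hψr⟩ := hsup z
    refine lt_of_le_of_lt (ContinuousLinearMap.opNorm_le_bound _ (le_max_right r 0) fun x => ?_)
      (max_lt hr one_pos)
    rw [hT, mul_apply_eq_comp, Unitary.norm_map]
    refine ContinuousLinearMap.le_of_opNorm_le _
      ((NonUnitalStarAlgHom.norm_apply_le (doubleRep ρ) _).trans ?_) x
    rw [norm_star, BoundedContinuousFunction.norm_le (le_max_right r 0)]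
    exact fun ψ => (hψr ψ ψ.2).trans (le_max_left r 0)
  refine ⟨hu, ?_⟩
  have hinv : Ring.inverse (1 - T) (WithLp.toLp 2 (v w₀, 0)) = WithLp.toLp 2 (v z, 0) := by
    have h1 : (1 - T) (WithLp.toLp 2 (v z, 0)) = WithLp.toLp 2 (v w₀, 0) := by
      rw [_root_.sub_apply, hTv, one_apply_eq_self, ← WithLp.toLp_sub]
      simp
    rw [← h1, ← mul_apply_eq_comp, Ring.inverse_mul_cancel _ hu, one_apply_eq_self]
  rw [mul_apply_eq_comp, map_smul, hinv, map_smul, inner_smul_left, inner_smul_right,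
    ← mul_assoc, hs, _root_.add_apply, hTv, one_apply_eq_self, ← WithLp.toLp_add,
    WithLp.prod_inner_apply]
  simp only [Prod.mk_add_mk, inner_add_left, inner_sub_left, hv0, add_zero, inner_zero_right]
  have hc : h w₀ - conj (h w₀) = 2 * (h w₀).im * Complex.I := by
    rw [Complex.sub_conj]
    push_cast
    ring
  linear_combination (1 / 2 : ℂ) * hc

/-- The Gram representation of `h(z) + conj h(w)`. -/
theorem exists_inner_sub_inner {S : Type} {Ψ : Set (S → ℂ)} {hΨ : ∀ ψ ∈ Ψ, ∀ z, ‖ψ z‖ ≤ 1}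
    (hne : Ψ.Nonempty) (hsup : ∀ z, ∃ r : ℝ, r < 1 ∧ ∀ ψ ∈ Ψ, ‖ψ z‖ ≤ r) {h : S → ℂ}
    (hre : ∀ z, 0 ≤ (h z).re)
    (hSA : (fun z => (h z - 1) / (h z + 1)) ∈ schurAglerClass Ψ) :
    ∃ (X : Type) (_ : NormedAddCommGroup X) (_ : InnerProductSpace ℂ X) (_ : CompleteSpace X)
      (ρ : (Ψ →ᵇ ℂ) →⋆ₐ[ℂ] (X →L[ℂ] X)) (v : S → X),
      ∀ z w, inner ℂ (v z) (v w) - inner ℂ (ρ (star (evalAt Ψ hΨ z)) (v z))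
        (ρ (star (evalAt Ψ hΨ w)) (v w)) = h z + conj (h w) := by
  -- The vectors `x` are unbounded, so the functions are controlled by the cone spanned by the
  -- `|x(z)|²`.
  let D : Submodule NNReal (Ψ × (S → ℂ) → ℝ) :=
    Submodule.span NNReal (Set.range fun z y => ‖y.2 z‖ ^ 2)
  let v (z : S) : sqDominated D :=
    ⟨fun y => y.2 z, fun y => ‖y.2 z‖ ^ 2, Submodule.subset_span ⟨z, rfl⟩, fun y => le_rfl⟩
  let u (z : S) : sqDominated D :=
    PosFunctional.mulSq Prod.fst (star (evalAt Ψ hΨ z)) (v z)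
  let g (p : S × S) : dominated D :=
    PosFunctional.conjMul (v p.1) (v p.2) - PosFunctional.conjMul (u p.1) (u p.2)
  let T := Finsupp.linearCombination ℂ g
  let ℓ := Finsupp.linearCombination ℂ fun p : S × S => h p.1 + conj (h p.2)
  have hg : ∀ p y, (g p).1 y =
      conj (y.2 p.1) * (1 - y.1.1 p.1 * conj (y.1.1 p.2)) * y.2 p.2 := fun p y => by
    have : (g p).1 y = conj (y.2 p.1) * y.2 p.2 -
        conj (conj (y.1.1 p.1) * y.2 p.1) * (conj (y.1.1 p.2) * y.2 p.2) := rfl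
    rw [this, map_mul, Complex.conj_conj]
    ring
  have hT : ∀ c y, (T c).1 y = c.sum fun p t =>
      t * (conj (y.2 p.1) * (1 - y.1.1 p.1 * conj (y.1.1 p.2)) * y.2 p.2) := fun c y => by
    simp only [← hg]
    simp [T, Finsupp.linearCombination_apply, Finsupp.sum]
  obtain ⟨L, hL⟩ := exists_posFunctional T ℓ
    (fun c hc => by
      refine re_sum_nonneg_of_mem_schurAglerClass hne (fun ψ hψ z => ?_) hre hSA c
        fun ψ hψ x => ?_
      · obtain ⟨r, hr, hr'⟩ := hsup z
        exact (hr' ψ hψ).trans_lt hr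
      · have := hc (⟨ψ, hψ⟩, x)
        rwa [hT] at this)
    (fun d hd => by
      induction hd using Submodule.span_induction with
      | mem d hd =>
        obtain ⟨z, rfl⟩ := hd
        obtain ⟨r, hr, hr'⟩ := hsup z
        have hR : 0 < 1 - max r 0 ^ 2 := by
          have := max_lt hr one_pos
          have := le_max_right r 0
          nlinarith
        -- Cofinality: `|ψ(z)| ≤ r < 1` gives `|x(z)|² ≤ (1 - r²)⁻¹ (1 - |ψ(z)|²) |x(z)|²`.
        refine ⟨Finsupp.single (z, z) (((1 - max r 0 ^ 2)⁻¹ : ℝ) : ℂ), fun y => ?_⟩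
        have h1 : ‖y.1.1 z‖ ^ 2 ≤ max r 0 ^ 2 := by
          gcongr
          exact (hr' _ y.1.2).trans (le_max_left _ _)
        have h2 : conj (y.2 z) * (1 - y.1.1 z * conj (y.1.1 z)) * y.2 z =
            (((1 - ‖y.1.1 z‖ ^ 2) * ‖y.2 z‖ ^ 2 : ℝ) : ℂ) := by
          rw [Complex.mul_conj, mul_right_comm, ← Complex.normSq_eq_conj_mul_self,
            Complex.normSq_eq_norm_sq, Complex.normSq_eq_norm_sq]
          push_cast
          ring
        rw [hT, Finsupp.sum_single_index (by simp), h2, ← Complex.ofReal_mul, Complex.ofReal_re,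
          ← mul_assoc]
        refine le_mul_of_one_le_left (sq_nonneg _) ?_
        rw [inv_mul_eq_div, one_le_div hR]
        linarith
      | zero => exact ⟨0, fun y => by simp⟩
      | add d d' _ _ ih ih' =>
        obtain ⟨c, hc⟩ := ih
        obtain ⟨c', hc'⟩ := ih'
        exact ⟨c + c', fun y => by simpa using add_le_add (hc y) (hc' y)⟩
      | smul a d _ ih =>
        obtain ⟨c, hc⟩ := ih
        refine ⟨((a : ℝ) : ℂ) • c, fun y => ?_⟩
        simpa [NNReal.smul_def] using mul_le_mul_of_nonneg_left (hc y) a.2)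
  refine ⟨L.L2, inferInstance, inferInstance, inferInstance, L.mulRep Prod.fst,
    fun z => (L.toPreL2 (v z) : L.L2), fun z w => ?_⟩
  rw [L.mulRep_apply, L.mulRep_apply, L.inner_coe_toPreL2, L.inner_coe_toPreL2, ← map_sub]
  have h1 : T (Finsupp.single (z, w) 1) = g (z, w) := by simp [T]
  have h2 : ℓ (Finsupp.single (z, w) 1) = h z + conj (h w) := by simp [ℓ]
  rw [← h2, ← hL, h1]

end Representation

/-! ### Holomorphic functions on domains -/

section Domains

variable {n : ℕ} {Ω : Set (EuclideanSpace ℂ (Fin n))}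

/-- `|a + conj b|² - |a - b|² = 4 Re a Re b`. -/
theorem norm_cayley_le_one {a b : ℂ} (ha : 0 ≤ a.re) (hb : 0 ≤ b.re) :
    ‖(a - b) / (a + conj b)‖ ≤ 1 := by
  rw [norm_div]
  refine div_le_one_of_le₀ ?_ (norm_nonneg _)
  rw [← sq_le_sq₀ (norm_nonneg _) (norm_nonneg _), ← Complex.normSq_eq_norm_sq,
    ← Complex.normSq_eq_norm_sq, Complex.normSq_apply, Complex.normSq_apply]
  simp
  nlinarith [mul_nonneg ha hb]

theorem norm_cayley_lt_one {a b : ℂ} (ha : 0 < a.re) (hb : 0 < b.re) :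
    ‖(a - b) / (a + conj b)‖ < 1 := by
  have hne : a + conj b ≠ 0 := fun h0 => by
    have := congrArg Complex.re h0
    simp at this
    linarith
  rw [norm_div, div_lt_one (norm_pos_iff.2 hne),
    ← sq_lt_sq₀ (norm_nonneg _) (norm_nonneg _), ← Complex.normSq_eq_norm_sq,
    ← Complex.normSq_eq_norm_sq, Complex.normSq_apply, Complex.normSq_apply]
  simp
  nlinarith [mul_pos ha hb]

theorem IsHolomorphic.cayley {h : Ω → ℂ} (hh : IsHolomorphic h) (hre : ∀ z, 0 ≤ (h z).re) {b : ℂ}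
    (hb : 0 < b.re) : IsHolomorphic fun z => (h z - b) / (h z + conj b) := by
  obtain ⟨H, hd, hH⟩ := hh
  have hne : ∀ z ∈ Ω, H z + conj b ≠ 0 := fun z hz h0 => by
    have h1 := congrArg Complex.re h0
    have h2 := hre ⟨z, hz⟩
    rw [← hH] at h2
    simp at h1
    linarith
  refine ⟨fun z => (H z - b) / (H z + conj b), ?_, fun z => by simp only [hH]⟩
  simp only [div_eq_mul_inv]
  exact (hd.sub_const b).mul ((hd.add_const (conj b)).inv hne)

theorem cayley_mem_schurClass {h : Ω → ℂ} (hh : IsHolomorphic h) (hre : ∀ z, 0 ≤ (h z).re) {b : ℂ}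
    (hb : 0 < b.re) : (fun z => (h z - b) / (h z + conj b)) ∈ schurClass Ω :=
  ⟨hh.cayley hre hb, fun z => norm_cayley_le_one (hre z) hb.le⟩

/-- A holomorphic function with nonnegative real part, somewhere zero, is constant. -/
theorem IsHolomorphic.eq_of_re_eq_zero {h : Ω → ℂ} (hΩ : IsDomainIn Ω) (hh : IsHolomorphic h)
    (hre : ∀ z, 0 ≤ (h z).re) {z₀ : Ω} (hz₀ : (h z₀).re = 0) (z : Ω) : h z = h z₀ := by
  have h1 : ∀ z, h z + 1 ≠ 0 := fun z h0 => by
    have h2 := congrArg Complex.re h0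
    simp at h2
    linarith [hre z]
  obtain ⟨⟨F, hd, hF⟩, hF1⟩ := cayley_mem_schurClass hh hre (b := 1) (by simp)
  simp only [map_one] at hF hF1
  have hz₀1 : ‖(h z₀ - 1) / (h z₀ + 1)‖ = 1 := by
    rw [norm_div, div_eq_one_iff_eq (norm_ne_zero_iff.2 (h1 z₀)),
      ← sq_eq_sq₀ (norm_nonneg _) (norm_nonneg _), ← Complex.normSq_eq_norm_sq,
      ← Complex.normSq_eq_norm_sq, Complex.normSq_apply, Complex.normSq_apply]
    simp [hz₀]
  -- The Cayley transform reaches its bound `1` at `z₀`, so the maximum principle makes it constant;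
  -- it is injective in the value of `h`.
  have key := Complex.eqOn_of_isPreconnected_of_isMaxOn_norm hΩ.2.isPreconnected hΩ.1 hd z₀.2
    (fun w hw => by
      change ‖F w‖ ≤ ‖F z₀‖
      rw [hF z₀, hz₀1, hF ⟨w, hw⟩]
      exact hF1 _) z.2
  simp only [Function.const, hF] at key
  rw [div_eq_div_iff (h1 z) (h1 z₀)] at key
  linear_combination key / 2

theorem hasHerglotzRepresentation_universalTestFunctions (hΩ : IsDomainIn Ω) {h : Ω → ℂ}
    (hh : IsHolomorphic h) (hre : ∀ z, 0 ≤ (h z).re) (w₀ : Ω) :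
    HasHerglotzRepresentation (universalTestFunctions w₀)
      (norm_le_one_of_mem_universalTestFunctions w₀) h := by
  by_cases hz : ∃ z₀, (h z₀).re = 0
  · obtain ⟨z₀, hz₀⟩ := hz
    have h0 : (0 : Ω → ℂ) ∈ universalTestFunctions w₀ :=
      ⟨0, ⟨⟨0, differentiableOn_const _, fun _ => rfl⟩, by simp⟩, by simp, by ext; simp⟩
    refine hasHerglotzRepresentation_of_eq_div h0 (by simp) (h z₀).im 0 le_rfl fun z => ?_
    rw [hh.eq_of_re_eq_zero hΩ hre hz₀ z]
    refine Complex.ext ?_ ?_ <;> simp [hz₀]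
  · push Not at hz
    have hpos : ∀ z, 0 < (h z).re := fun z => lt_of_le_of_ne (hre z) (hz z).symm
    let f : Ω → ℂ := fun z => (h z - h w₀) / (h z + conj (h w₀))
    have hf1 : ∀ z, ‖f z‖ < 1 := fun z => norm_cayley_lt_one (hpos z) (hpos w₀)
    have hf : (fun z => -f z) ∈ universalTestFunctions w₀ :=
      ⟨f, cayley_mem_schurClass hh hre (hpos w₀), hf1, by ext; simp [f]⟩
    refine hasHerglotzRepresentation_of_eq_div hf (by simpa using hf1) (h w₀).im (h w₀).re
      (hre w₀) fun z => ?_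
    have hne : ∀ z, h z + conj (h w₀) ≠ 0 := fun z h0 => by
      have := congrArg Complex.re h0
      simp at this
      linarith [hpos z, hpos w₀]
    have hne1 : h w₀ + conj (h w₀) ≠ 0 := hne w₀
    have hdiv : (1 - -f z) / (1 + -f z) = (2 * h z + conj (h w₀) - h w₀) / (h w₀ + conj (h w₀)) := by
      have h1 : 1 - -f z = (2 * h z + conj (h w₀) - h w₀) / (h z + conj (h w₀)) := by
        simp only [f]
        field_simp [hne z]
        ring
      have h2 : 1 + -f z = (h w₀ + conj (h w₀)) / (h z + conj (h w₀)) := by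
        simp only [f]
        field_simp [hne z]
        ring
      rw [h1, h2, div_div_div_cancel_right₀ (hne z)]
    rw [hdiv]
    have h3 : ((h w₀).re : ℂ) = (h w₀ + conj (h w₀)) / 2 := by
      rw [Complex.add_conj]; push_cast; ring
    have h4 : Complex.I * ((h w₀).im : ℂ) = (h w₀ - conj (h w₀)) / 2 := by
      rw [Complex.sub_conj]; push_cast; ring
    rw [h3, h4]
    field_simp
    ring

/-- Constants alone do not separate two points. -/
theorem IsTestFunctions.nonempty {S : Type*} [Nontrivial S] {Ψ : Set (S → ℂ)}
    (hΨ : IsTestFunctions Ψ) : Ψ.Nonempty := by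
  classical
  by_contra hne
  rw [Set.not_nonempty_iff_eq_empty] at hne
  obtain ⟨a, b, hab⟩ := exists_pair_ne S
  have h := hΨ.generates {a, b}
  rw [hne, Set.image_empty, Algebra.adjoin_empty] at h
  have hf : (fun x : ({a, b} : Finset S) => if x.1 = a then (1 : ℂ) else 0) ∈
      (⊥ : Subalgebra ℂ (({a, b} : Finset S) → ℂ)) := h ▸ Algebra.mem_top
  obtain ⟨r, hr⟩ := Algebra.mem_bot.1 hf
  have h1 := congrFun hr ⟨a, by simp⟩
  have h2 := congrFun hr ⟨b, by simp⟩
  simp [hab.symm] at h1 h2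
  simp [h1] at h2

/-- Excludes the one-point domain of `n = 0`, where `Ψ = ∅` would qualify; then `C_b(Ψ) = 0` forces
`X = 0`, and only imaginary constants are represented. -/
theorem IsDomainIn.nontrivial (hn : 1 ≤ n) (hΩ : IsDomainIn Ω) : Nontrivial Ω := by
  have : Nonempty (Fin n) := ⟨⟨0, hn⟩⟩
  obtain ⟨x, hx⟩ := hΩ.2.nonempty
  have : (nhdsWithin x {x}ᶜ).NeBot := Module.punctured_nhds_neBot ℂ _ x
  exact ((infinite_of_mem_nhds x (hΩ.1.mem_nhds hx)).nontrivial).coe_sort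

theorem hasHerglotzRepresentation_of_schurAglerClass_eq [Nontrivial Ω] {h : Ω → ℂ}
    (hh : IsHolomorphic h) (hre : ∀ z, 0 ≤ (h z).re) {Ψ : Set (Ω → ℂ)}
    {hΨ : ∀ ψ ∈ Ψ, ∀ z, ‖ψ z‖ ≤ 1} (w₀ : Ω) (hw₀ : ∀ ψ ∈ Ψ, ψ w₀ = 0) (hT : IsTestFunctions Ψ)
    (hSA : schurAglerClass Ψ = schurClass Ω) : HasHerglotzRepresentation Ψ hΨ h := by
  have hf := cayley_mem_schurClass hh hre (b := 1) (by simp)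
  rw [← hSA, map_one] at hf
  obtain ⟨X, _, _, _, ρ, v, hv⟩ :=
    exists_inner_sub_inner (hΨ := hΨ) hT.nonempty hT.sup_lt_one hre hf
  exact hasHerglotzRepresentation_of_inner_sub_inner w₀ hw₀ hT.sup_lt_one ρ v hv

end Domains

end HerglotzRep

theorem mainTheorem3 {n : ℕ} (hn : 1 ≤ n) (Ω : Set (EuclideanSpace ℂ (Fin n)))
    (hΩ : HerglotzRep.IsDomainIn Ω) (hyp : HerglotzRep.IsCaratheodoryHyperbolic Ω)
    (h : Ω → ℂ) (hh : HerglotzRep.IsHolomorphic h) :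
    (∀ w₀ : Ω,
      (∀ z, 0 ≤ (h z).re) ↔
        HerglotzRep.HasHerglotzRepresentation (HerglotzRep.universalTestFunctions w₀)
          (HerglotzRep.norm_le_one_of_mem_universalTestFunctions w₀) h) ∧
    (∀ (Ψ : Set (Ω → ℂ)) (hΨ : Ψ ⊆ HerglotzRep.schurClass Ω) (w₀ : Ω),
      (∀ ψ ∈ Ψ, ψ w₀ = 0) →
      HerglotzRep.IsTestFunctions Ψ →
      HerglotzRep.schurAglerClass Ψ = HerglotzRep.schurClass Ω →
      ((∀ z, 0 ≤ (h z).re) ↔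
        HerglotzRep.HasHerglotzRepresentation Ψ (fun ψ hψ => (hΨ hψ).2) h)) := by
  refine ⟨fun w₀ => ⟨fun hre =>
    HerglotzRep.hasHerglotzRepresentation_universalTestFunctions hΩ hh hre w₀,
    fun H => H.re_nonneg⟩, fun _ _ w₀ hw₀ hT hSA => ⟨fun hre => ?_, fun H => H.re_nonneg⟩⟩
  have := hΩ.nontrivial hn
  exact HerglotzRep.hasHerglotzRepresentation_of_schurAglerClass_eq hh hre w₀ hw₀ hT hSA
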